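/- Setting. An instance consists of $n\ge 1$ candidates; candidate $i$ has a value $\rho_i\ge 0$ for the receiver and a value $\xi_i\ge 0$ for the sender, where the $\rho_i$ are pairwise distinct and the $\xi_i$ are pairwise distinct. Both players know all pairs $(\rho_i,\xi_i)$. The candidates arrive in $n$ rounds in uniformly random order. A (direct) mechanism, to which the sender commits and which is known to the receiver, chooses in each round $t$, possibly at random, a signal HIRE or NOT, depending on the candidates that arrived in rounds $1,\dots,t$ and on the earlier signals. After each signal the receiver irrevocably hires the current candidate, which ends the process, or rejects it. In round $t$ she has seen the signals of rounds $1,\dots,t$ and, in the scenario with disclosure, also the identities of the candidates rejected in rounds $1,\dots,t-1$; without disclosure she sees only the signals. The receiver maximizes the expected $\rho$-value of the hired candidate ($0$ if nobody is hired). A mechanism is persuasive if in every round that an obedient receiver can reach with positive probability, conditional on everything she has observed, no deviating strategy for the current and later rounds gives her a strictly larger expected value than obedience (hire upon HIRE, reject upon NOT). The value of a persuasive mechanism for the sender is computed for the obedient receiver: for cardinal sender utility it is the expected $\xi$-value of the hired candidate, for ordinal sender utility the probability that the candidate with the largest $\xi$-value is hired. The benchmark optimum $\mathrm{OPT}$ of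 an instance is the largest value for the sender that a persuasive mechanism achieves in the scenario without disclosure. Theorem. For every $\varepsilon>0$ there is an instance such that, for cardinal as well as for ordinal sender utility, the benchmark optimum $\mathrm{OPT}$ exists and every mechanism that is persuasive in the scenario with disclosure has value at most $\left(\frac12+\varepsilon\right)\mathrm{OPT}$ for the sender. -/

import Mathlib

namespace Persuasion

/-- The valuation pairs of the candidates `0, …, n - 1`: candidate `i` has value `recv i` for the
receiver and `send i` for the sender.  Values are non-negative, and for each of the two players
the values of different candidates are different. -/
structure Instance (n : ℕ) where
  recv : Fin n → ℝ
  send : Fin n → ℝ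
  recv_nonneg : ∀ i, 0 ≤ recv i
  send_nonneg : ∀ i, 0 ≤ send i
  recv_injective : Function.Injective recv
  send_injective : Function.Injective send

/-- What the receiver learns about candidates that she rejected. -/
inductive Scenario
  | noDisclosure
  | disclosure

/-- The objective of the sender: the expected value of the hired candidate, or the probability
that the hired candidate is the sender-optimal one. -/
inductive Objective
  | cardinal
  | ordinal

/-- The sender's payoff when candidate `i` is hired. -/
noncomputable def Instance.senderPayoff {n : ℕ} (I : Instance n) : Objective → Fin n → ℝ
  | .cardinal, i => I.send i
  | .ordinal, i => open Classical in if ∀ j, I.send j ≤ I.send i then 1 else 0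

/-- An arrival order: `π t` is the candidate that arrives in round `t`. -/
abbrev Order (n : ℕ) := Equiv.Perm (Fin n)

/-- The signals of all rounds: `true` is HIRE and `false` is NOT. -/
abbrev Signals (n : ℕ) := Fin n → Bool

/-- A direct (randomized) signaling mechanism: the probability of the signal HIRE in round `t`,
given the candidates that arrived in rounds `0, …, t` and the signals of rounds `0, …, t - 1`.
(Rounds are numbered from `0`.  If round `t` is reached, then all earlier candidates were
rejected, so this is all that the sender can condition on.) -/
abbrev Mechanism (n : ℕ) :=
  (t : Fin n) → (Fin (t + 1) → Fin n) → (Fin t → Bool) → unitInterval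

/-- The probability of HIRE in round `t` when the candidates arrive in the order `π` and the
signals before round `t` are those of `σ`. -/
def Mechanism.hireProb {n : ℕ} (φ : Mechanism n) (π : Order n) (σ : Signals n) (t : Fin n) : ℝ :=
  φ t (fun s => π (Fin.castLE t.isLt s)) (fun s => σ (Fin.castLE t.isLt.le s))

/-- The joint probability of the arrival order `π` (uniform) and the signals `σ` that the
mechanism sends along it as long as nobody is hired. -/
noncomputable def Mechanism.prob {n : ℕ} (φ : Mechanism n) (π : Order n) (σ : Signals n) : ℝ :=
  (1 / (Nat.factorial n : ℝ)) *
    ∏ t, if σ t = true then φ.hireProb π σ t else 1 - φ.hireProb π σ t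

/-- Expectation over the random arrival order and the random signals. -/
noncomputable def Mechanism.expect {n : ℕ} (φ : Mechanism n) (f : Order n → Signals n → ℝ) : ℝ :=
  ∑ π : Order n, ∑ σ : Signals n, φ.prob π σ * f π σ

/-- The information about the candidates of rounds `0, …, t - 1` that is disclosed to the
receiver when she rejects them. -/
def Revealed : Scenario → ℕ → ℕ → Type
  | .noDisclosure, _, _ => Unit
  | .disclosure, n, t => Fin t → Fin n

/-- What the receiver has seen when she decides in round `t`: the signals of rounds `0, …, t`
and the disclosed information about the rejected candidates. -/
abbrev Observation (d : Scenario) (n : ℕ) (t : Fin n) :=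
  (Fin (t + 1) → Bool) × Revealed d n t

def revealed {n : ℕ} (d : Scenario) (π : Order n) (t : Fin n) : Revealed d n t :=
  match d with
  | .noDisclosure => ()
  | .disclosure => fun s => π (Fin.castLE t.isLt.le s)

def observe {n : ℕ} (d : Scenario) (π : Order n) (σ : Signals n) (t : Fin n) :
    Observation d n t :=
  (fun s => σ (Fin.castLE t.isLt s), revealed d π t)

/-- A strategy of the receiver: whether to hire in round `t`, given the observation.
(Randomized strategies are mixtures of these and cannot achieve more.) -/
abbrev Strategy (d : Scenario) (n : ℕ) := (t : Fin n) → Observation d n t → Bool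

/-- The obedient strategy: hire if and only if the current signal is HIRE. -/
def obedient (d : Scenario) (n : ℕ) : Strategy d n := fun t o => o.1 (Fin.last t)

/-- The value under `u` of the candidate that the strategy `τ` hires when round `start` is reached
and `τ` is followed from that round on; it is `0` if nobody is hired. -/
noncomputable def payoffFrom {n : ℕ} {d : Scenario} (start : ℕ) (τ : Strategy d n)
    (u : Fin n → ℝ) (π : Order n) (σ : Signals n) : ℝ :=
  ∑ t : Fin n,
    open Classical in
    if start ≤ (t : ℕ) ∧ τ t (observe d π σ t) = true ∧
        ∀ s : Fin n, start ≤ (s : ℕ) → s < t → τ s (observe d π σ s) = false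
    then u (π t) else 0

/-- A mechanism is persuasive if in every round the receiver, who wants to maximize the expected
value of the hired candidate, cannot gain by deviating from obedience in this round and/or later
ones.  The round and the observation `o` range over those that an obedient receiver can reach, so
all signals before the current one are NOT.  Both sides are multiplied by the probability of `o`;
if that is positive, the inequality compares the expectations conditional on `o`. -/
def Mechanism.IsPersuasive {n : ℕ} (φ : Mechanism n) (d : Scenario) (I : Instance n) : Prop :=
  ∀ (t : Fin n) (o : Observation d n t), (∀ s : Fin t, o.1 s.castSucc = false) →
    ∀ τ : Strategy d n,
      φ.expect (fun π σ => open Classical in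
          if observe d π σ t = o then payoffFrom t τ I.recv π σ else 0) ≤
        φ.expect (fun π σ => open Classical in
          if observe d π σ t = o then payoffFrom t (obedient d n) I.recv π σ else 0)

/-- The expected payoff of the sender when the receiver is obedient. -/
noncomputable def Mechanism.senderValue {n : ℕ} (φ : Mechanism n) (d : Scenario) (I : Instance n)
    (obj : Objective) : ℝ :=
  φ.expect (payoffFrom 0 (obedient d n) (I.senderPayoff obj))

/-- `v` is the optimum of the benchmark scenario: the largest value for the sender of a persuasive
mechanism in the basic scenario without disclosure. -/
def Instance.IsBenchmarkOptimum {n : ℕ} (I : Instance n) (obj : Objective) (v : ℝ) : Prop :=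
  IsGreatest {x : ℝ | ∃ φ : Mechanism n,
    φ.IsPersuasive .noDisclosure I ∧ x = φ.senderValue .noDisclosure I obj} v

end Persuasion

/-! In the instance, `A` is worth `2 * n!` to the receiver, `B` is worth nothing to her but is the
sender's best candidate, and everyone else is worth about 1 to her and at most `1 / n` to the
sender.

Without disclosure the sender can almost always place `B`. The mechanism hires `A` if `A` or a dummy
candidate `c` comes first, and `B` otherwise, so it yields at least `1 - 2 / n`. The receiver learns
only the hiring round, so a HIRE might always mean `A`. Because of the orders starting with `c`,
after every signal strictly more orders give her `A` under obedience than under a deviation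
(`card_hire_lt`, `card_not_lt`). One extra order with `A` outweighs everything else
(`sum_le_sum_of_card_lt`).

With disclosure, a receiver who sees that `A` has been rejected knows that only values in `[1, 1 + 1
/ n]` and the 0 of `B` remain. Hiring the next candidate secures 1 unless it is `B`, so obedience is
acceptable only if `B` is rarely hired from then on (`expect_hired_le`). Hence `B` is essentially
hired only when it precedes `A`, which has probability 1/2.

The benchmark optimum exists by compactness of the space of mechanisms. -/

namespace Persuasion

open Finset

/-! ### Expectations under a mechanism -/

section Expectation

variable {n : ℕ} (φ : Mechanism n)

/-- The last signal occurs only in the last factor, whose two possible values add up to 1; peeling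
it off gives the induction. -/
theorem sum_prod_signals (n : ℕ) (g : (t : Fin n) → (Fin t → Bool) → ℝ) :
    ∑ σ : Fin n → Bool, ∏ t : Fin n,
      (if σ t = true then g t (fun s => σ (Fin.castLE t.isLt.le s))
        else 1 - g t (fun s => σ (Fin.castLE t.isLt.le s))) = 1 := by
  induction n with
  | zero => simp
  | succ n ih =>
    have h1 : ∀ (b : Bool) (σ : Fin n → Bool) (t : Fin n), g t.castSucc (fun s =>
        (Fin.snoc σ b : Fin (n + 1) → Bool) (Fin.castLE (t.castSucc).isLt.le s)) =
        g t.castSucc (fun s : Fin t => σ (Fin.castLE t.isLt.le s)) := fun b σ t =>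
      congrArg (g t.castSucc) (funext fun s =>
        Fin.snoc_castSucc (α := fun _ => Bool) b σ (Fin.castLE t.isLt.le s))
    have h2 : ∀ (b : Bool) (σ : Fin n → Bool), g (Fin.last n) (fun s =>
        (Fin.snoc σ b : Fin (n + 1) → Bool) (Fin.castLE (Fin.last n).isLt.le s)) =
        g (Fin.last n) σ := fun b σ =>
      congrArg (g (Fin.last n)) (funext fun s => Fin.snoc_castSucc (α := fun _ => Bool) b σ s)
    have h3 : ∀ (b : Bool) (σ : Fin n → Bool), (∏ t : Fin (n + 1),
        (if (Fin.snoc σ b : Fin (n + 1) → Bool) t = true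
          then g t (fun s => (Fin.snoc σ b : Fin (n + 1) → Bool) (Fin.castLE t.isLt.le s))
          else 1 - g t (fun s => (Fin.snoc σ b : Fin (n + 1) → Bool) (Fin.castLE t.isLt.le s)))) =
        (∏ t : Fin n, (if σ t = true then g t.castSucc (fun s : Fin t => σ (Fin.castLE t.isLt.le s))
          else 1 - g t.castSucc (fun s : Fin t => σ (Fin.castLE t.isLt.le s)))) *
        (if b = true then g (Fin.last n) σ else 1 - g (Fin.last n) σ) := by
      intro b σ
      rw [Fin.prod_univ_castSucc]
      congr 1
      · refine Finset.prod_congr rfl fun t _ => ?_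
        rw [h1 b σ t, Fin.snoc_castSucc (α := fun _ => Bool)]
      · rw [h2 b σ, Fin.snoc_last]
    refine Eq.trans ?_ (ih (fun t h => g t.castSucc h))
    refine ((Fin.snocEquiv (fun _ : Fin (n + 1) => Bool)).sum_comp _).symm.trans ?_
    rw [Fintype.sum_prod_type_right]
    refine Finset.sum_congr rfl fun σ _ => ?_
    refine (Fintype.sum_bool _).trans ((congrArg₂ (· + ·) (h3 true σ) (h3 false σ)).trans ?_)
    simp only [if_true, Bool.false_eq_true, if_false]
    ring

theorem Mechanism.hireProb_mem (π : Order n) (σ : Signals n) (t : Fin n) :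
    φ.hireProb π σ t ∈ Set.Icc (0 : ℝ) 1 := Subtype.property _

theorem Mechanism.prob_nonneg (π : Order n) (σ : Signals n) : 0 ≤ φ.prob π σ := by
  refine mul_nonneg (by positivity) (Finset.prod_nonneg fun t _ => ?_)
  have h := φ.hireProb_mem π σ t
  split_ifs
  · exact h.1
  · linarith [h.2]

theorem Mechanism.sum_prob (π : Order n) :
    ∑ σ, φ.prob π σ = 1 / (Nat.factorial n : ℝ) := by
  unfold Mechanism.prob Mechanism.hireProb
  rw [← Finset.mul_sum,
    sum_prod_signals n (fun t h => (φ t (fun s => π (Fin.castLE t.isLt s)) h : ℝ)), mul_one]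

theorem Mechanism.expect_mono {f g : Order n → Signals n → ℝ} (h : ∀ π σ, f π σ ≤ g π σ) :
    φ.expect f ≤ φ.expect g :=
  Finset.sum_le_sum fun π _ => Finset.sum_le_sum fun σ _ =>
    mul_le_mul_of_nonneg_left (h π σ) (φ.prob_nonneg π σ)

theorem Mechanism.expect_add (f g : Order n → Signals n → ℝ) :
    φ.expect (fun π σ => f π σ + g π σ) = φ.expect f + φ.expect g := by
  simp only [Mechanism.expect, mul_add, Finset.sum_add_distrib]

theorem Mechanism.expect_sum {ι : Type*} (s : Finset ι) (f : ι → Order n → Signals n → ℝ) :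
    φ.expect (fun π σ => ∑ i ∈ s, f i π σ) = ∑ i ∈ s, φ.expect (f i) := by
  simp only [Mechanism.expect, Finset.mul_sum]
  rw [Finset.sum_comm]
  simp only [Finset.sum_comm (s := s)]
  rw [Finset.sum_comm]

theorem Mechanism.expect_order (f : Order n → ℝ) :
    φ.expect (fun π _ => f π) = (1 / (Nat.factorial n : ℝ)) * ∑ π, f π := by
  simp only [Mechanism.expect, ← Finset.sum_mul, φ.sum_prob, ← Finset.mul_sum]

end Expectation

/-! ### The round in which a strategy hires -/

section Payoff

variable {n : ℕ} {d : Scenario} {k : ℕ} {τ : Strategy d n} {π : Order n} {σ : Signals n}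

theorem payoffFrom_eq_of_first (u : Fin n → ℝ) {r : Fin n} (hk : k ≤ r)
    (hr : τ r (observe d π σ r) = true)
    (hs : ∀ s : Fin n, k ≤ (s : ℕ) → s < r → τ s (observe d π σ s) = false) :
    payoffFrom k τ u π σ = u (π r) := by
  unfold payoffFrom
  rw [Finset.sum_eq_single r, if_pos ⟨hk, hr, hs⟩]
  · intro t _ ht
    refine if_neg ?_
    rintro ⟨h1, h2, h3⟩
    rcases lt_or_gt_of_ne ht with h | h
    · simp [hs t h1 h] at h2
    · simp [h3 r hk h] at hr
  · simp

theorem payoffFrom_eq_zero (u : Fin n → ℝ)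
    (hs : ∀ s : Fin n, k ≤ (s : ℕ) → τ s (observe d π σ s) = false) :
    payoffFrom k τ u π σ = 0 := by
  refine Finset.sum_eq_zero fun t _ => if_neg ?_
  rintro ⟨h1, h2, -⟩
  simp [hs t h1] at h2

/-- The hiring round does not depend on the valuation, so a single `r` serves all `u`. This allows
payoffs under different valuations to be compared along the same play. -/
theorem payoffFrom_cases (k : ℕ) (τ : Strategy d n) (π : Order n) (σ : Signals n) :
    (∀ u, payoffFrom k τ u π σ = 0) ∨
      ∃ r : Fin n, k ≤ (r : ℕ) ∧ τ r (observe d π σ r) = true ∧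
        (∀ s : Fin n, k ≤ (s : ℕ) → s < r → τ s (observe d π σ s) = false) ∧
        ∀ u, payoffFrom k τ u π σ = u (π r) := by
  classical
  by_cases h : ∃ r : Fin n, k ≤ (r : ℕ) ∧ τ r (observe d π σ r) = true
  · right
    obtain ⟨r, ⟨h1, h2⟩, h3⟩ := WellFounded.has_min (wellFounded_lt (α := Fin n))
      {r | k ≤ (r : ℕ) ∧ τ r (observe d π σ r) = true} h
    have h4 : ∀ s : Fin n, k ≤ (s : ℕ) → s < r → τ s (observe d π σ s) = false := by
      intro s hs hsr
      by_contra hc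
      exact h3 s ⟨hs, by simpa using hc⟩ hsr
    exact ⟨r, h1, h2, h4, fun u => payoffFrom_eq_of_first u h1 h2 h4⟩
  · left
    push Not at h
    exact fun u => payoffFrom_eq_zero u fun s hs => by simpa using h s hs

theorem payoffFrom_succ (u : Fin n → ℝ) (t : Fin n) (ht : τ t (observe d π σ t) = false) :
    payoffFrom t τ u π σ = payoffFrom (t + 1) τ u π σ := by
  rcases payoffFrom_cases t τ π σ with h | ⟨r, h1, h2, h3, h4⟩
  · rw [h]
    symm
    by_contra hne
    rcases payoffFrom_cases (t + 1) τ π σ with h' | ⟨r, h1, h2, h3, h4⟩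
    · exact hne (h' u)
    -- The constant valuation 1 detects whether anybody is hired, contradicting `h`.
    · have := payoffFrom_eq_of_first (k := t) (fun _ => (1 : ℝ)) (by omega) h2 (fun s hs hsr => by
        rcases eq_or_lt_of_le hs with he | hl
        · rw [← Fin.ext he]; exact ht
        · exact h3 s hl hsr)
      rw [h] at this
      norm_num at this
  · have hne : t ≠ r := by rintro rfl; simp [ht] at h2
    have hlt : (t : ℕ) < r := lt_of_le_of_ne h1 fun h => hne (Fin.ext h)
    rw [h4, payoffFrom_eq_of_first u hlt h2 fun s hs => h3 s (by omega)]

@[simp]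
theorem obedient_observe (t : Fin n) : obedient d n t (observe d π σ t) = σ t := rfl

end Payoff

/-! ### Existence of the benchmark optimum -/

section Compactness

variable {n : ℕ}

theorem Mechanism.continuous_expect (f : Order n → Signals n → ℝ) :
    Continuous fun φ : Mechanism n => φ.expect f := by
  have h : ∀ (π : Order n) (σ : Signals n) (t : Fin n),
      Continuous fun φ : Mechanism n => φ.hireProb π σ t := by
    intro π σ t
    unfold Mechanism.hireProb
    fun_prop
  unfold Mechanism.expect Mechanism.prob
  refine continuous_finsetSum _ fun π _ => continuous_finsetSum _ fun σ _ => ?_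
  refine (continuous_const.mul (continuous_finsetProd _ fun t _ => ?_)).mul continuous_const
  split_ifs
  · exact h π σ t
  · exact continuous_const.sub (h π σ t)

/-- Multiplied by the probability of the observation, the constraints are weak inequalities between
continuous functions of the mechanism. Conditional expectations would not be continuous where that
probability vanishes. -/
theorem Mechanism.isClosed_isPersuasive (d : Scenario) (I : Instance n) :
    IsClosed {φ : Mechanism n | φ.IsPersuasive d I} := by
  unfold Mechanism.IsPersuasive
  simp only [Set.ofPred_forall]
  refine isClosed_iInter fun t => isClosed_iInter fun o => isClosed_iInter fun _ =>
    isClosed_iInter fun τ => ?_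
  exact isClosed_le (Mechanism.continuous_expect _) (Mechanism.continuous_expect _)

/-- The benchmark optimum exists as soon as some mechanism is persuasive. -/
theorem Instance.exists_isBenchmarkOptimum (I : Instance n) (obj : Objective) {φ : Mechanism n}
    (hφ : φ.IsPersuasive .noDisclosure I) :
    ∃ v, I.IsBenchmarkOptimum obj v ∧ φ.senderValue .noDisclosure I obj ≤ v := by
  obtain ⟨ψ, hψ, hmax⟩ := (Mechanism.isClosed_isPersuasive .noDisclosure I).isCompact.exists_isMaxOn
    ⟨φ, hφ⟩ (Mechanism.continuous_expect
      (payoffFrom 0 (obedient .noDisclosure n) (I.senderPayoff obj))).continuousOn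
  refine ⟨_, ⟨⟨ψ, hψ, rfl⟩, ?_⟩, hmax hφ⟩
  rintro x ⟨χ, hχ, rfl⟩
  exact hmax hχ

end Compactness

/-! ### The instance and bounds on its values -/

section GapInstance

variable {n : ℕ} {A B : Fin n}

theorem index_div_sq_nonneg (i : Fin n) : 0 ≤ (i : ℝ) / (n : ℝ) ^ 2 := by positivity

/-- The perturbation `i / n ^ 2` only serves to make values distinct; this bound makes its effect an
error term. -/
theorem index_div_sq_le (i : Fin n) : (i : ℝ) / (n : ℝ) ^ 2 ≤ 1 / n := by
  have hn : (0 : ℝ) < n := by exact_mod_cast i.pos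
  have hi : (i : ℝ) < n := by exact_mod_cast i.isLt
  rw [div_le_div_iff₀ (by positivity) hn]
  nlinarith

theorem index_div_sq_lt_one (i : Fin n) : (i : ℝ) / (n : ℝ) ^ 2 < 1 := by
  have hn : (1 : ℝ) ≤ n := by exact_mod_cast i.pos
  have hi : (i : ℝ) < n := by exact_mod_cast i.isLt
  rw [div_lt_one (by positivity)]
  nlinarith

theorem index_div_sq_inj {i j : Fin n} (h : (i : ℝ) / (n : ℝ) ^ 2 = (j : ℝ) / (n : ℝ) ^ 2) :
    i = j := by
  have hn : (n : ℝ) ^ 2 ≠ 0 := by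
    have : (0 : ℝ) < n := by exact_mod_cast i.pos
    positivity
  have := (div_left_inj' hn).1 h
  exact Fin.ext (by exact_mod_cast this)

/-- Candidate `A` is by far the best one for the receiver, and candidate `B` is the best one for
the sender and the worst one for the receiver.  All other candidates are worth about `1` for the
receiver and about `0` for the sender. -/
noncomputable def gapInstance (A B : Fin n) : Instance n where
  recv i := if i = B then 0 else if i = A then 2 * (Nat.factorial n : ℝ)
    else 1 + (i : ℝ) / (n : ℝ) ^ 2
  send i := if i = B then 1 else (i : ℝ) / (n : ℝ) ^ 2
  recv_nonneg i := by
    have := index_div_sq_nonneg i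
    split_ifs <;> positivity
  send_nonneg i := by
    have := index_div_sq_nonneg i
    split_ifs <;> positivity
  recv_injective i j h := by
    have hi := index_div_sq_nonneg i
    have hj := index_div_sq_nonneg j
    have hi' := index_div_sq_lt_one i
    have hj' := index_div_sq_lt_one j
    have hf : (1 : ℝ) ≤ Nat.factorial n := by exact_mod_cast Nat.succ_le_of_lt (Nat.factorial_pos n)
    dsimp only at h
    split_ifs at h with h1 h2 h3 h4 h5 h6 h7 h8
    all_goals first
      | (subst_vars; rfl)
      | (exfalso; linarith)
      | exact index_div_sq_inj (by linarith)
  send_injective i j h := by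
    have hi' := index_div_sq_lt_one i
    have hj' := index_div_sq_lt_one j
    dsimp only at h
    split_ifs at h
    all_goals first
      | (subst_vars; rfl)
      | (exfalso; linarith)
      | exact index_div_sq_inj h

theorem gapInstance_recv_B : (gapInstance A B).recv B = 0 := by simp [gapInstance]

theorem gapInstance_recv_A (hAB : A ≠ B) :
    (gapInstance A B).recv A = 2 * (Nat.factorial n : ℝ) := by simp [gapInstance, hAB]

theorem one_le_gapInstance_recv {i : Fin n} (hi : i ≠ B) : 1 ≤ (gapInstance A B).recv i := by
  have := index_div_sq_nonneg i
  have hf : (1 : ℝ) ≤ Nat.factorial n := by exact_mod_cast Nat.succ_le_of_lt (Nat.factorial_pos n)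
  simp only [gapInstance, if_neg hi]
  split_ifs <;> linarith

theorem gapInstance_recv_le {i : Fin n} (hi : i ≠ A) :
    (gapInstance A B).recv i ≤ 1 + 1 / n := by
  have h := index_div_sq_le i
  have h' := index_div_sq_nonneg i
  simp only [gapInstance, if_neg hi]
  split_ifs <;> linarith

theorem gapInstance_senderPayoff_B (obj : Objective) :
    (gapInstance A B).senderPayoff obj B = 1 := by
  cases obj with
  | cardinal => simp [Instance.senderPayoff, gapInstance]
  | ordinal =>
    refine if_pos fun j => ?_
    have := (index_div_sq_lt_one j).le
    simp only [gapInstance, if_true]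
    split_ifs <;> linarith

theorem gapInstance_senderPayoff_nonneg (obj : Objective) (i : Fin n) :
    0 ≤ (gapInstance A B).senderPayoff obj i := by
  cases obj with
  | cardinal => exact (gapInstance A B).send_nonneg i
  | ordinal => unfold Instance.senderPayoff; dsimp only; split_ifs <;> norm_num

theorem gapInstance_senderPayoff_le (obj : Objective) (i : Fin n) :
    (gapInstance A B).senderPayoff obj i ≤ (if i = B then 1 else 0) + 1 / n := by
  have hn : (0 : ℝ) ≤ 1 / n := by positivity
  by_cases hi : i = B
  · rw [hi, gapInstance_senderPayoff_B, if_pos rfl]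
    linarith
  · rw [if_neg hi, zero_add]
    cases obj with
    | cardinal =>
      simpa [Instance.senderPayoff, gapInstance, hi] using index_div_sq_le i
    | ordinal =>
      refine (if_neg ?_).trans_le hn
      intro h
      have h1 := h B
      simp only [gapInstance, if_true, if_neg hi] at h1
      linarith [index_div_sq_lt_one i]

end GapInstance

/-! ### Persuasiveness on observable events -/

section Disclosure

variable {n : ℕ} {I : Instance n} {φ : Mechanism n}

open Classical in
/-- Given any event that the receiver observes before round `t`, hiring the candidate of round `t`
irrespective of the signal is not better for her than obedience. -/
theorem Mechanism.IsPersuasive.expect_recv_le (hφ : φ.IsPersuasive .disclosure I) (t : Fin n)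
    (Q : (Fin t → Fin n) → Prop) :
    φ.expect (fun π σ => if (∀ s : Fin n, s < t → σ s = false) ∧
        Q (fun s => π (Fin.castLE t.isLt.le s)) then I.recv (π t) else 0) ≤
      φ.expect (fun π σ => if (∀ s : Fin n, s < t → σ s = false) ∧
        Q (fun s => π (Fin.castLE t.isLt.le s)) then
          payoffFrom t (obedient .disclosure n) I.recv π σ else 0) := by
  -- The event is a disjoint union of single observations, to each of which persuasiveness applies.
  have key : ∀ X : Order n → Signals n → ℝ,
      φ.expect (fun π σ => if (∀ s : Fin n, s < t → σ s = false) ∧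
        Q (fun s => π (Fin.castLE t.isLt.le s)) then X π σ else 0) =
      ∑ o ∈ (univ : Finset ((Fin (t + 1) → Bool) × (Fin t → Fin n))) with
        (∀ s : Fin t, o.1 s.castSucc = false) ∧ Q o.2,
        φ.expect (fun π σ => if observe .disclosure π σ t = o then X π σ else 0) := by
    intro X
    rw [← φ.expect_sum]
    congr 1
    funext π σ
    have hiff : ((∀ s : Fin n, s < t → σ s = false) ∧
        Q (fun s => π (Fin.castLE t.isLt.le s))) ↔
        ((fun s => σ (Fin.castLE t.isLt s), fun s => π (Fin.castLE t.isLt.le s)) :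
          (Fin (t + 1) → Bool) × (Fin t → Fin n)) ∈
        (univ.filter fun o : (Fin (t + 1) → Bool) × (Fin t → Fin n) =>
          (∀ s : Fin t, o.1 s.castSucc = false) ∧ Q o.2) := by
      simp only [mem_filter, mem_univ, true_and]
      refine and_congr_left fun _ => ⟨fun h s => h _ s.isLt, fun h s hs => h ⟨s, hs⟩⟩
    by_cases hc : (∀ s : Fin n, s < t → σ s = false) ∧
        Q (fun s => π (Fin.castLE t.isLt.le s))
    · rw [if_pos hc]
      rw [Finset.sum_eq_single_of_mem _ (hiff.1 hc)]
      · exact (if_pos rfl).symm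
      · intro o _ ho
        exact if_neg fun h => ho h.symm
    · rw [if_neg hc]
      symm
      refine Finset.sum_eq_zero fun o ho => if_neg fun h => hc (hiff.2 ?_)
      rw [← h] at ho
      exact ho
  rw [key, key]
  refine Finset.sum_le_sum fun o ho => ?_
  -- The deviation that always hires stops in round `t` at once.
  have h := hφ t o (mem_filter.1 ho).2.1 (fun _ _ => true)
  refine (le_of_eq ?_).trans (h.trans (le_of_eq ?_))
  on_goal 2 => congr 1; funext π σ; split_ifs <;> rfl
  congr 1
  funext π σ
  split_ifs
  · exact (payoffFrom_eq_of_first I.recv le_rfl rfl fun s h1 h2 => absurd h1 (by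
      simpa using h2)).symm
  · rfl

end Disclosure

/-! ### Symmetry counts for random orders -/

section Counting

variable {n : ℕ}

theorem sum_order_swap_mul (x y : Fin n) (f : Order n → ℝ) :
    ∑ π : Order n, f (Equiv.swap x y * π) = ∑ π, f π :=
  Equiv.sum_comp (Equiv.mulLeft (Equiv.swap x y)) f

theorem card_order : (Fintype.card (Order n) : ℝ) = Nat.factorial n := by
  rw [Fintype.card_perm, Fintype.card_fin]

theorem sum_before {A B : Fin n} (hAB : A ≠ B) :
    ∑ π : Order n, (if π.symm B < π.symm A then (1 : ℝ) else 0) = Nat.factorial n / 2 := by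
  have h := sum_order_swap_mul A B fun π : Order n => if π.symm B < π.symm A then (1 : ℝ) else 0
  have h2 : ∑ π : Order n, ((if π.symm B < π.symm A then (1 : ℝ) else 0) +
      (if (Equiv.swap A B * π).symm B < (Equiv.swap A B * π).symm A then (1 : ℝ) else 0)) =
      Nat.factorial n := by
    rw [← card_order, ← nsmul_one, ← Finset.card_univ, ← Finset.sum_const]
    refine Finset.sum_congr rfl fun π _ => ?_
    have h1 : (Equiv.swap A B * π).symm B = π.symm A := by
      simp [Equiv.symm_apply_eq]
    have h2 : (Equiv.swap A B * π).symm A = π.symm B := by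
      simp [Equiv.symm_apply_eq]
    rw [h1, h2]
    rcases lt_or_gt_of_ne (fun h => hAB (π.symm.injective h)) with h | h
    · simp [h, h.not_gt]
    · simp [h, h.not_gt]
  rw [Finset.sum_add_distrib] at h2
  linarith

/-- By symmetry `B` can be replaced by any of the `n - 1` candidates other than `A`, and at most one
of them directly follows `A`. -/
theorem sum_adjacent_le {A B : Fin n} (hAB : A ≠ B) :
    ((n : ℝ) - 1) * ∑ π : Order n,
      (if (π.symm A : ℕ) + 1 = π.symm B then (1 : ℝ) else 0) ≤ Nat.factorial n := by
  have h : ∀ x ∈ univ.erase A, ∑ π : Order n,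
      (if (π.symm A : ℕ) + 1 = π.symm x then (1 : ℝ) else 0) =
      ∑ π : Order n, (if (π.symm A : ℕ) + 1 = π.symm B then (1 : ℝ) else 0) := by
    intro x hx
    rw [← sum_order_swap_mul x B]
    refine Finset.sum_congr rfl fun π _ => ?_
    have h1 : (Equiv.swap x B * π).symm A = π.symm A := by
      rw [Equiv.symm_apply_eq, Equiv.Perm.mul_apply, Equiv.apply_symm_apply,
        Equiv.swap_apply_of_ne_of_ne (Finset.ne_of_mem_erase hx).symm hAB]
    have h2 : (Equiv.swap x B * π).symm x = π.symm B := by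
      simp [Equiv.symm_apply_eq]
    rw [h1, h2]
  have hc : ((n : ℝ) - 1) = #(univ.erase A) := by
    rw [Finset.card_erase_of_mem (mem_univ _), Finset.card_univ, Fintype.card_fin,
      Nat.cast_sub A.pos, Nat.cast_one]
  rw [hc, ← nsmul_eq_mul, ← Finset.sum_const, ← Finset.sum_congr rfl h, Finset.sum_comm,
    ← card_order, ← nsmul_one, ← Finset.card_univ, ← Finset.sum_const]
  refine Finset.sum_le_sum fun π _ => ?_
  rw [Finset.sum_boole]
  have : #{x ∈ univ.erase A | (π.symm A : ℕ) + 1 = π.symm x} ≤ 1 := by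
    rw [Finset.card_le_one]
    intro x hx y hy
    exact π.symm.injective (Fin.ext ((mem_filter.1 hx).2.symm.trans (mem_filter.1 hy).2))
  exact_mod_cast this

theorem sum_apply_eq (t x : Fin n) :
    (n : ℝ) * ∑ π : Order n, (if π t = x then (1 : ℝ) else 0) = Nat.factorial n := by
  have h : ∀ y ∈ (univ : Finset (Fin n)), ∑ π : Order n, (if π t = y then (1 : ℝ) else 0) =
      ∑ π : Order n, (if π t = x then (1 : ℝ) else 0) := by
    intro y _
    rw [← sum_order_swap_mul y x]
    refine Finset.sum_congr rfl fun π _ => ?_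
    simp only [Equiv.Perm.mul_apply, Equiv.swap_apply_eq_iff, Equiv.swap_apply_left]
  have hc : (n : ℝ) = #(univ : Finset (Fin n)) := by simp
  rw [hc, ← nsmul_eq_mul, ← Finset.sum_const, ← Finset.sum_congr rfl h, Finset.sum_comm]
  simp only [Finset.sum_ite_eq, Finset.mem_univ, if_true]
  rw [Finset.sum_const, nsmul_one, Finset.card_univ, card_order]

end Counting

/-! ### Upper bound with disclosure -/

section DisclosureBound

variable {n : ℕ} {A B : Fin n} {φ : Mechanism n}

/-- Just before round `t`, nobody has been hired, candidate `A` has been rejected in the previous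
round, and candidate `B` has not arrived. -/
def JustRejected (A B : Fin n) (t : Fin n) (π : Order n) (σ : Signals n) : Prop :=
  (∀ s : Fin n, s < t → σ s = false) ∧ (π.symm A : ℕ) + 1 = t ∧ t ≤ π.symm B

-- After `A` is gone, each hire of `B` costs the obedient receiver about 1, while hiring the next
-- candidate at once fails to give her 1 only if that candidate is `B`. The term `1 / n` covers the
-- spread of the remaining values.
open Classical in
theorem Mechanism.IsPersuasive.expect_hired_le
    (hφ : φ.IsPersuasive .disclosure (gapInstance A B)) (hAB : A ≠ B) (t : Fin n) :
    φ.expect (fun π σ => if JustRejected A B t π σ then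
      payoffFrom t (obedient .disclosure n) (fun i => if i = B then 1 else 0) π σ else 0) ≤
    φ.expect (fun π _ => if (π.symm A : ℕ) + 1 = t ∧ π.symm B = t then 1 else 0) +
    φ.expect (fun π _ => if (π.symm A : ℕ) + 1 = t then 1 / n else 0) := by
  have h := hφ.expect_recv_le t fun b => (∃ s : Fin t, (s : ℕ) + 1 = t ∧ b s = A) ∧ ∀ s, b s ≠ B
  have hev : ∀ π σ, ((∀ s : Fin n, s < t → σ s = false) ∧
      (∃ s : Fin t, (s : ℕ) + 1 = t ∧ π (Fin.castLE t.isLt.le s) = A) ∧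
      ∀ s : Fin t, π (Fin.castLE t.isLt.le s) ≠ B) ↔ JustRejected A B t π σ := by
    intro π σ
    refine and_congr_right fun _ => and_congr ⟨?_, ?_⟩ ⟨?_, ?_⟩
    · rintro ⟨s, hs, rfl⟩
      simpa using hs
    · intro h
      exact ⟨⟨π.symm A, by omega⟩, h, by
        rw [show Fin.castLE t.isLt.le ⟨π.symm A, _⟩ = π.symm A from Fin.ext rfl]; simp⟩
    · intro h
      by_contra hc
      refine h ⟨π.symm B, by simpa using hc⟩ ?_
      rw [show Fin.castLE t.isLt.le ⟨π.symm B, _⟩ = π.symm B from Fin.ext rfl]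
      simp
    · rintro h s rfl
      rw [Equiv.symm_apply_apply] at h
      exact absurd s.isLt (not_lt.2 h)
  simp only [hev] at h
  -- Pointwise on the event, the left side is at most `1 + 1 / n`, whether `B`, another candidate or
  -- nobody is hired, and the right side is at least that.
  have h1 : φ.expect (fun π σ => if JustRejected A B t π σ then
      payoffFrom t (obedient .disclosure n) (gapInstance A B).recv π σ else 0) +
      φ.expect (fun π σ => if JustRejected A B t π σ then
      payoffFrom t (obedient .disclosure n) (fun i => if i = B then 1 else 0) π σ else 0) ≤
      φ.expect (fun π σ => if JustRejected A B t π σ then (gapInstance A B).recv (π t) else 0) +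
      (φ.expect (fun π _ => if (π.symm A : ℕ) + 1 = t ∧ π.symm B = t then 1 else 0) +
      φ.expect (fun π _ => if (π.symm A : ℕ) + 1 = t then 1 / n else 0)) := by
    rw [← φ.expect_add, ← φ.expect_add, ← φ.expect_add]
    refine φ.expect_mono fun π σ => ?_
    have hn : (0 : ℝ) ≤ 1 / n := by positivity
    by_cases hE : JustRejected A B t π σ
    · obtain ⟨-, hA, hB⟩ := id hE
      rw [if_pos hE, if_pos hE, if_pos hE, if_pos hA]
      have hlow : (1 : ℝ) ≤ (gapInstance A B).recv (π t) +
          (if (π.symm A : ℕ) + 1 = t ∧ π.symm B = t then 1 else 0) := by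
        by_cases ht : π.symm B = t
        · rw [if_pos ⟨hA, ht⟩]
          linarith [(gapInstance A B).recv_nonneg (π t)]
        · have : π t ≠ B := fun h => ht (by rw [← h]; simp)
          have := one_le_gapInstance_recv (A := A) this
          split_ifs <;> linarith
      rcases payoffFrom_cases t (obedient .disclosure n) π σ with h0 | ⟨r, hr, -, -, hu⟩
      · rw [h0, h0]
        linarith
      · rw [hu, hu]
        have hrA : π r ≠ A := by
          intro h
          rw [← h, Equiv.symm_apply_apply] at hA
          omega
        by_cases hrB : π r = B
        · rw [hrB, if_pos rfl, gapInstance_recv_B]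
          linarith
        · rw [if_neg hrB]
          linarith [gapInstance_recv_le (B := B) hrA]
    · rw [if_neg hE, if_neg hE, if_neg hE]
      split_ifs <;> linarith
  linarith

/-- With disclosure, the sender gets hardly more than half of the value of her best candidate. -/
theorem Mechanism.IsPersuasive.senderValue_gapInstance_le
    (hφ : φ.IsPersuasive .disclosure (gapInstance A B)) (hAB : A ≠ B) (obj : Objective) :
    φ.senderValue .disclosure (gapInstance A B) obj ≤ 1 / 2 + 1 / (n - 1) + 2 / n := by
  classical
  have hn2 : (1 : ℝ) < n := by
    have : 1 < n := by
      by_contra hc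
      exact hAB (Fin.ext (by omega))
    exact_mod_cast this
  have hn : (0 : ℝ) ≤ 1 / n := by positivity
  have hfac : (0 : ℝ) < Nat.factorial n := by exact_mod_cast Nat.factorial_pos n
  -- A hired candidate other than `B` costs `1 / n`; a hire of `B` is charged to `B` preceding `A`,
  -- or else to the round just after `A`.
  have h1 : φ.senderValue .disclosure (gapInstance A B) obj ≤
      φ.expect (fun π _ => (if π.symm B < π.symm A then 1 else 0) + 1 / n) +
      φ.expect (fun π σ => ∑ t, if JustRejected A B t π σ then
        payoffFrom t (obedient .disclosure n) (fun i => if i = B then 1 else 0) π σ else 0) := by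
    rw [← φ.expect_add]
    refine φ.expect_mono fun π σ => ?_
    have hnn : ∀ t : Fin n, 0 ≤ (if JustRejected A B t π σ then
        payoffFrom t (obedient .disclosure n) (fun i => if i = B then (1 : ℝ) else 0) π σ
        else 0) := by
      intro t
      rcases payoffFrom_cases t (obedient .disclosure n) π σ with h0 | ⟨r, -, -, -, hu⟩
      · rw [h0]; split_ifs <;> norm_num
      · rw [hu]; split_ifs <;> norm_num
    have hsum := Finset.sum_nonneg fun t (_ : t ∈ univ) => hnn t
    have hbef : (0 : ℝ) ≤ if π.symm B < π.symm A then 1 else 0 := by split_ifs <;> norm_num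
    rcases payoffFrom_cases 0 (obedient .disclosure n) π σ with h0 | ⟨r, -, hr, hs, hu⟩
    · rw [h0]
      linarith
    · rw [hu]
      have hle := gapInstance_senderPayoff_le (A := A) (B := B) obj (π r)
      by_cases hrB : π r = B
      · rw [if_pos hrB] at hle
        by_cases hBA : π.symm B < π.symm A
        · rw [if_pos hBA]
          linarith
        · have hlt : π.symm A < π.symm B :=
            lt_of_le_of_ne (not_lt.1 hBA) fun h => hAB (π.symm.injective h)
          have hrB' : π.symm B = r := by rw [← hrB]; simp
          have hlt' : (π.symm A : ℕ) < r := by rw [← hrB']; exact hlt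
          -- The round after `A` exists because `B` arrives later than `A`.
          have hJ : JustRejected A B ⟨π.symm A + 1, by omega⟩ π σ := by
            refine ⟨fun s hs' => hs s (by simp) ?_, rfl, hlt⟩
            have : (s : ℕ) < π.symm A + 1 := hs'
            exact Fin.lt_def.2 (by omega)
          have hone := Finset.single_le_sum (fun t _ => hnn t)
            (mem_univ (⟨π.symm A + 1, by omega⟩ : Fin n))
          rw [if_pos hJ, payoffFrom_eq_of_first (r := r) _ hlt' hr fun s _ => hs s (by simp),
            if_pos hrB] at hone
          linarith
      · rw [if_neg hrB] at hle
        linarith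
  have h2 := Finset.sum_le_sum fun t (_ : t ∈ univ) => hφ.expect_hired_le hAB t
  rw [← φ.expect_sum, Finset.sum_add_distrib, ← φ.expect_sum, ← φ.expect_sum] at h2
  have h3 : φ.expect (fun π _ => (if π.symm B < π.symm A then (1 : ℝ) else 0) + 1 / n) =
      1 / 2 + 1 / n := by
    rw [φ.expect_order, Finset.sum_add_distrib, sum_before hAB, Finset.sum_const, Finset.card_univ,
      nsmul_eq_mul, card_order]
    field_simp
  have h4 : φ.expect (fun π _ => ∑ t : Fin n,
      if (π.symm A : ℕ) + 1 = t ∧ π.symm B = t then (1 : ℝ) else 0) ≤ 1 / (n - 1) := by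
    rw [φ.expect_order]
    have hadj := sum_adjacent_le hAB
    have : ∀ π : Order n, (∑ t : Fin n,
        if (π.symm A : ℕ) + 1 = t ∧ π.symm B = t then (1 : ℝ) else 0) =
        if (π.symm A : ℕ) + 1 = π.symm B then (1 : ℝ) else 0 := by
      intro π
      rw [Finset.sum_eq_single (π.symm B)]
      · simp
      · exact fun t _ ht => if_neg fun h => ht h.2.symm
      · simp
    simp only [this]
    rw [one_div_mul_eq_div, div_le_div_iff₀ hfac (by linarith)]
    linarith
  have h5 : φ.expect (fun π _ => ∑ t : Fin n,
      if (π.symm A : ℕ) + 1 = t then 1 / (n : ℝ) else 0) ≤ 1 / n := by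
    have : ∀ π : Order n, (∑ t : Fin n,
        if (π.symm A : ℕ) + 1 = t then 1 / (n : ℝ) else 0) ≤ 1 / n := by
      intro π
      rw [← Finset.sum_filter, Finset.sum_const, nsmul_eq_mul]
      refine mul_le_of_le_one_left hn ?_
      have : #{t : Fin n | (π.symm A : ℕ) + 1 = t} ≤ 1 := by
        rw [Finset.card_le_one]
        intro x hx y hy
        exact Fin.ext ((mem_filter.1 hx).2.symm.trans (mem_filter.1 hy).2)
      exact_mod_cast this
    refine (φ.expect_mono fun π _ => this π).trans ?_
    rw [φ.expect_order, Finset.sum_const, Finset.card_univ, nsmul_eq_mul, card_order]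
    field_simp
    exact le_rfl
  have h6 : (2 : ℝ) / n = 1 / n + 1 / n := by ring
  linarith

end DisclosureBound

/-! ### Backward induction without disclosure -/

section Stopping

variable {n : ℕ}

/-- The signal HIRE in round `s` only. -/
def hireAt (s : Fin n) : Signals n := fun t => decide (t = s)

/-- Observations ignore the arrival order, so it can be moved into the valuation. With the signals
fixed, the stopping round is then the same for all orders. -/
theorem payoffFrom_noDisclosure (k : ℕ) (τ : Strategy .noDisclosure n) (u : Fin n → ℝ)
    (π : Order n) (σ : Signals n) :
    payoffFrom k τ u π σ = payoffFrom k τ (fun i => u (π i)) 1 σ := rfl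

theorem payoffFrom_obedient_hireAt {d : Scenario} {k : ℕ} {s : Fin n} (u : Fin n → ℝ)
    (π : Order n) (hk : k ≤ s) : payoffFrom k (obedient d n) u π (hireAt s) = u (π s) :=
  payoffFrom_eq_of_first u hk (by simp [hireAt]) fun r _ hr => by simp [hireAt, hr.ne]

variable {u : Fin n → ℝ} {p : Order n → Fin n}

/-- After HIRE in round `t` all later signals are NOT and carry no information, so every strategy
amounts to a fixed round `r ≥ t` or to hiring nobody. -/
theorem sum_payoffFrom_of_hire (hu : ∀ i, 0 ≤ u i)
    (H : ∀ t r : Fin n, t < r → ∑ π with p π = t, u (π r) ≤ ∑ π with p π = t, u (π t))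
    (t : Fin n) (τ : Strategy .noDisclosure n) :
    ∑ π with p π = t, payoffFrom t τ u π (hireAt (p π)) ≤ ∑ π with p π = t, u (π (p π)) := by
  have h1 : ∑ π with p π = t, payoffFrom t τ u π (hireAt (p π)) =
      ∑ π with p π = t, payoffFrom t τ (fun i => u (π i)) 1 (hireAt t) :=
    Finset.sum_congr rfl fun π hπ => by rw [payoffFrom_noDisclosure, (mem_filter.1 hπ).2]
  have h2 : ∑ π with p π = t, u (π (p π)) = ∑ π with p π = t, u (π t) :=
    Finset.sum_congr rfl fun π hπ => by rw [(mem_filter.1 hπ).2]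
  rw [h1, h2]
  rcases payoffFrom_cases t τ 1 (hireAt t) with h | ⟨r, hr, -, -, h⟩
  · simp only [h, Finset.sum_const_zero]
    exact Finset.sum_nonneg fun π _ => hu _
  · simp only [h, Equiv.Perm.one_apply]
    rcases eq_or_lt_of_le (show t ≤ r from hr) with rfl | hlt
    · exact le_rfl
    · exact H t r hlt

/-- The observation of round `t` in which all signals are NOT. -/
def allNot (t : Fin n) : Observation .noDisclosure n t := (fun _ => false, ())

theorem observe_of_lt {t s : Fin n} (π : Order n) (h : t < s) :
    observe .noDisclosure π (hireAt s) t = allNot t := by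
  refine Prod.ext (funext fun i => ?_) rfl
  have : Fin.castLE t.isLt i ≠ s := by
    rintro rfl
    have h1 : (t : ℕ) < i := h
    omega
  simp [observe, hireAt, allNot, this]

theorem sum_payoffFrom_of_not
    (N : ∀ t : Fin n, ∑ π with t < p π, u (π t) ≤ ∑ π with t < p π, u (π (p π)))
    (t : Fin n) (τ : Strategy .noDisclosure n)
    (ih : ∑ π with (t : ℕ) + 1 ≤ p π, payoffFrom (t + 1) τ u π (hireAt (p π)) ≤
      ∑ π with (t : ℕ) + 1 ≤ p π, u (π (p π))) :
    ∑ π with t < p π, payoffFrom t τ u π (hireAt (p π)) ≤ ∑ π with t < p π, u (π (p π)) := by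
  by_cases hτ : τ t (allNot t) = true
  · refine le_trans (Finset.sum_le_sum fun π hπ => le_of_eq ?_) (N t)
    refine payoffFrom_eq_of_first u le_rfl ?_ fun s h1 h2 => absurd h1 (by simpa using h2)
    rw [observe_of_lt π (mem_filter.1 hπ).2, hτ]
  · refine le_trans (Finset.sum_le_sum fun π hπ => le_of_eq ?_) ih
    refine payoffFrom_succ u t ?_
    rw [observe_of_lt π (mem_filter.1 hπ).2]
    simpa using hτ

/-- Backward induction on `k`: `H` settles the orders with HIRE in round `k`. On the others the
receiver either hires despite NOT, which `N` covers, or goes on to round `k + 1`. -/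
theorem sum_payoffFrom_le (hu : ∀ i, 0 ≤ u i)
    (H : ∀ t r : Fin n, t < r → ∑ π with p π = t, u (π r) ≤ ∑ π with p π = t, u (π t))
    (N : ∀ t : Fin n, ∑ π with t < p π, u (π t) ≤ ∑ π with t < p π, u (π (p π)))
    (τ : Strategy .noDisclosure n) {k : ℕ} (hk : k ≤ n) :
    ∑ π with k ≤ (p π : ℕ), payoffFrom k τ u π (hireAt (p π)) ≤
      ∑ π with k ≤ (p π : ℕ), u (π (p π)) := by
  induction hk using Nat.decreasingInduction with
  | self =>
    have : (univ.filter fun π : Order n => n ≤ (p π : ℕ)) = ∅ :=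
      Finset.filter_eq_empty_iff.2 fun π _ => not_le.2 (p π).isLt
    simp [this]
  | of_succ k hk ih =>
    have hsplit : ∀ f : Order n → ℝ, ∑ π with k ≤ (p π : ℕ), f π =
        ∑ π with p π = ⟨k, hk⟩, f π + ∑ π with ⟨k, hk⟩ < p π, f π := by
      intro f
      rw [← Finset.sum_union]
      · congr 1
        ext π
        simp only [mem_filter, mem_univ, true_and, mem_union, Fin.ext_iff, Fin.lt_def]
        omega
      · refine Finset.disjoint_filter.2 fun π _ h1 h2 => ?_
        rw [h1] at h2
        exact lt_irrefl _ h2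
    rw [hsplit, hsplit]
    exact add_le_add (sum_payoffFrom_of_hire hu H ⟨k, hk⟩ τ)
      (sum_payoffFrom_of_not N ⟨k, hk⟩ τ ih)

end Stopping

/-! ### The mechanism for the benchmark -/

section TargetMechanism

variable {n : ℕ}

/-- The candidate to be hired, as a function of the first candidate. -/
def target (A B c x : Fin n) : Fin n := if x = A ∨ x = c then A else B

/-- Hire the candidate that the first candidate determines. -/
noncomputable def targetMechanism (A B c : Fin n) : Mechanism n :=
  fun t x _ => if x (Fin.last t) = target A B c (x 0) then 1 else 0

/-- The round in which the target arrives; `z` is the first round. -/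
def hireRound (A B c z : Fin n) (π : Order n) : Fin n := π.symm (target A B c (π z))

variable {A B c z : Fin n}

@[simp]
theorem apply_hireRound (π : Order n) : π (hireRound A B c z π) = target A B c (π z) := by
  simp [hireRound]

theorem hireRound_eq_iff {π : Order n} {t : Fin n} :
    hireRound A B c z π = t ↔ π t = target A B c (π z) := by
  rw [hireRound, Equiv.symm_apply_eq, eq_comm]

theorem targetMechanism_hireProb (hz : (z : ℕ) = 0) (π : Order n) (σ : Signals n) (t : Fin n) :
    (targetMechanism A B c).hireProb π σ t = if hireAt (hireRound A B c z π) t then 1 else 0 := by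
  have h0 : Fin.castLE t.isLt (0 : Fin (t + 1)) = z := Fin.ext (by simp [hz])
  have hl : Fin.castLE t.isLt (Fin.last t) = t := Fin.ext rfl
  have h : t = hireRound A B c z π ↔ π t = target A B c (π z) := by
    rw [eq_comm, hireRound_eq_iff]
  simp only [Mechanism.hireProb, targetMechanism, h0, hl, hireAt, decide_eq_true_eq, h]
  split_ifs <;> rfl

/-- The mechanism ignores its earlier signals and is deterministic, so each order carries one signal
sequence, with a single HIRE; even a disobeyed HIRE is followed only by NOT. -/
theorem targetMechanism_prob (hz : (z : ℕ) = 0) (π : Order n) (σ : Signals n) :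
    (targetMechanism A B c).prob π σ =
      if σ = hireAt (hireRound A B c z π) then 1 / (Nat.factorial n : ℝ) else 0 := by
  unfold Mechanism.prob
  simp only [targetMechanism_hireProb hz]
  split_ifs with h
  · subst h
    rw [Finset.prod_eq_one, mul_one]
    intro t _
    split_ifs <;> norm_num
  · obtain ⟨t, ht⟩ := Function.ne_iff.1 h
    rw [Finset.prod_eq_zero (mem_univ t), mul_zero]
    cases h1 : σ t <;> cases h2 : hireAt (hireRound A B c z π) t <;> simp_all

theorem targetMechanism_expect (hz : (z : ℕ) = 0) (f : Order n → Signals n → ℝ) :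
    (targetMechanism A B c).expect f =
      1 / (Nat.factorial n : ℝ) * ∑ π, f π (hireAt (hireRound A B c z π)) := by
  simp only [Mechanism.expect, targetMechanism_prob hz, ite_mul, zero_mul, Finset.sum_ite_eq',
    mem_univ, if_true, Finset.mul_sum]

theorem targetMechanism_isPersuasive (hz : (z : ℕ) = 0) (I : Instance n)
    (H : ∀ t r : Fin n, t < r → ∑ π with hireRound A B c z π = t, I.recv (π r) ≤
      ∑ π with hireRound A B c z π = t, I.recv (π t))
    (N : ∀ t : Fin n, ∑ π with t < hireRound A B c z π, I.recv (π t) ≤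
      ∑ π with t < hireRound A B c z π, I.recv (π (hireRound A B c z π))) :
    (targetMechanism A B c).IsPersuasive .noDisclosure I := by
  classical
  intro t o ho τ
  rw [targetMechanism_expect hz, targetMechanism_expect hz]
  refine mul_le_mul_of_nonneg_left ?_ (by positivity)
  have hobs : ∀ s : Fin n, observe .noDisclosure 1 (hireAt s) t = o ↔
      if o.1 (Fin.last t) = true then s = t else t < s := by
    intro s
    have hlast : (observe .noDisclosure 1 (hireAt s) t).1 (Fin.last t) = decide (t = s) := rfl
    have hcast : ∀ i : Fin t, (observe .noDisclosure 1 (hireAt s) t).1 i.castSucc =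
        decide (Fin.castLE t.isLt.le i = s) := fun i => rfl
    constructor
    · intro h
      rw [h] at hlast hcast
      have h2 : t ≤ s := by
        by_contra hc
        have h3 := hcast ⟨s, by simpa using hc⟩
        rw [ho] at h3
        simp at h3
      split_ifs with h1
      · rw [h1] at hlast
        exact (by simpa using hlast : t = s).symm
      · refine lt_of_le_of_ne h2 fun h => h1 ?_
        simp [hlast, h]
    · intro h
      have h2 : t ≤ s := by
        split_ifs at h
        · exact h.ge
        · exact h.le
      refine Prod.ext (funext fun i => ?_) rfl
      refine Fin.lastCases ?_ (fun i => ?_) i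
      · rw [hlast]
        split_ifs at h with h1
        · simp [h1, h]
        · rw [Bool.eq_false_of_not_eq_true h1]
          simp [h.ne]
      · rw [hcast, ho]
        simp only [decide_eq_false_iff_not]
        rintro rfl
        have h3 : (t : ℕ) ≤ i := h2
        omega
  have hobs' : ∀ π, observe .noDisclosure π (hireAt (hireRound A B c z π)) t = o ↔
      if o.1 (Fin.last t) = true then hireRound A B c z π = t else t < hireRound A B c z π :=
    fun π => hobs (hireRound A B c z π)
  have hIH := fun k hk => sum_payoffFrom_le I.recv_nonneg H N τ (k := k) hk
  by_cases h1 : o.1 (Fin.last t) = true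
  · simp only [hobs', h1, if_true]
    rw [← Finset.sum_filter, ← Finset.sum_filter]
    refine (sum_payoffFrom_of_hire I.recv_nonneg H t τ).trans (Finset.sum_le_sum fun π hπ => ?_)
    rw [payoffFrom_obedient_hireAt]
    exact (mem_filter.1 hπ).2.ge
  · simp only [hobs', h1]
    rw [← Finset.sum_filter, ← Finset.sum_filter]
    refine (sum_payoffFrom_of_not N t τ (hIH _ t.isLt)).trans (Finset.sum_le_sum fun π hπ => ?_)
    rw [payoffFrom_obedient_hireAt]
    exact (mem_filter.1 hπ).2.le

end TargetMechanism

/-! ### Obedience maximizes the chance of the best candidate -/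

section Dominance

variable {n : ℕ}

/-- All candidates other than `A` together contribute at most `2 * #D ≤ 2 * n! = u A`, no more than
the one additional order with `A` is worth. -/
theorem sum_le_sum_of_card_lt {A : Fin n} {u : Fin n → ℝ} (hu : ∀ i, 0 ≤ u i)
    (hA : u A = 2 * (Nat.factorial n : ℝ)) (hle : ∀ i, i ≠ A → u i ≤ 2)
    (D : Finset (Order n)) (f g : Order n → Fin n)
    (h : #{π ∈ D | f π = A} < #{π ∈ D | g π = A}) :
    ∑ π ∈ D, u (f π) ≤ ∑ π ∈ D, u (g π) := by
  have hD : (#D : ℝ) ≤ Nat.factorial n := by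
    have h := Finset.card_le_univ D
    rw [Fintype.card_perm, Fintype.card_fin] at h
    exact_mod_cast h
  have h1 : ∑ π ∈ D, u (f π) ≤ ∑ π ∈ D, (u A * (if f π = A then 1 else 0) + 2) := by
    refine Finset.sum_le_sum fun π _ => ?_
    split_ifs with hf
    · rw [hf]; linarith
    · linarith [hle _ hf]
  have h2 : ∑ π ∈ D, u A * (if g π = A then 1 else 0) ≤ ∑ π ∈ D, u (g π) := by
    refine Finset.sum_le_sum fun π _ => ?_
    split_ifs with hg
    · rw [hg, mul_one]
    · linarith [hu (g π)]
  rw [Finset.sum_add_distrib, ← Finset.mul_sum, Finset.sum_boole, Finset.sum_const,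
    nsmul_eq_mul] at h1
  rw [← Finset.mul_sum, Finset.sum_boole] at h2
  have h3 : (#{π ∈ D | f π = A} : ℝ) + 1 ≤ #{π ∈ D | g π = A} := by exact_mod_cast h
  have h4 := mul_le_mul_of_nonneg_left h3 (hu A)
  linarith

theorem exists_order₂ {a b x y : Fin n} (hab : a ≠ b) (hxy : x ≠ y) :
    ∃ π : Order n, π a = x ∧ π b = y := by
  obtain ⟨π, hπ⟩ := MulAction.is_two_pretransitive_iff.1
    (Equiv.Perm.isMultiplyPretransitive (Fin n) 2) hab hxy
  exact ⟨π, hπ⟩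

theorem exists_order₃ {a b c x y w : Fin n} (hab : a ≠ b) (hac : a ≠ c) (hbc : b ≠ c)
    (hxy : x ≠ y) (hxw : x ≠ w) (hyw : y ≠ w) :
    ∃ π : Order n, π a = x ∧ π b = y ∧ π c = w := by
  have hinj : ∀ {a b c : Fin n}, a ≠ b → a ≠ c → b ≠ c → Function.Injective ![a, b, c] := by
    intro a b c hab hac hbc i j h
    fin_cases i <;> fin_cases j <;> simp_all [eq_comm]
  obtain ⟨π, hπ⟩ := Equiv.Perm.exists_extending_pair ![a, b, c] ![x, y, w]
    (hinj hab hac hbc) (hinj hxy hxw hyw)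
  exact ⟨π, hπ 0, hπ 1, hπ 2⟩

theorem card_order_two {a b x y a' b' x' y' : Fin n} (hab : a ≠ b) (hxy : x ≠ y)
    (hab' : a' ≠ b') (hxy' : x' ≠ y') :
    #{π : Order n | π a = x ∧ π b = y} = #{π : Order n | π a' = x' ∧ π b' = y'} := by
  obtain ⟨g, hg, hg'⟩ := exists_order₂ hab' hab
  obtain ⟨h, hh, hh'⟩ := exists_order₂ hxy hxy'
  refine Finset.card_equiv ((Equiv.mulLeft h).trans (Equiv.mulRight g)) fun π => ?_
  simp only [mem_filter, mem_univ, true_and, Equiv.trans_apply, Equiv.coe_mulLeft,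
    Equiv.coe_mulRight, Equiv.Perm.mul_apply, hg, hg', ← hh, ← hh', h.injective.eq_iff]

variable {A B c z : Fin n}

/-- If `A` is still to come after HIRE in round `t`, then `B` is the current candidate. In the first
round this is rarer than `A` being there. Later, the orders with `c` first and `A` in round `t` are
as many as those with `B` in round `t` and `A` in round `r`, and among the latter those starting
with `c` do not lead to HIRE in round `t`. -/
theorem card_hire_lt (hAB : A ≠ B) (hAc : A ≠ c) (hBc : B ≠ c)
    {t r : Fin n} (htr : t < r) (hzt : z ≤ t) :
    #{π ∈ univ.filter (fun π : Order n => hireRound A B c z π = t) | π r = A} <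
      #{π ∈ univ.filter (fun π : Order n => hireRound A B c z π = t) | π t = A} := by
  simp only [hireRound_eq_iff, Finset.filter_filter]
  have hsub : (univ.filter fun π : Order n => π t = target A B c (π z) ∧ π r = A) ⊆
      univ.filter fun π : Order n => π t = B ∧ π r = A := by
    intro π hπ
    simp only [mem_filter, mem_univ, true_and] at hπ ⊢
    obtain ⟨h1, h2⟩ := hπ
    refine ⟨?_, h2⟩
    unfold target at h1
    split_ifs at h1
    · exact absurd (π.injective (h1.trans h2.symm)) htr.ne
    · exact h1
  rcases eq_or_lt_of_le hzt with rfl | hlt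
  · refine (Finset.card_le_card hsub).trans_lt ?_
    rw [card_order_two htr.ne hAB.symm htr.ne hAc]
    obtain ⟨π, h1, h2⟩ := exists_order₂ htr.ne hAB
    refine Finset.card_lt_card ((Finset.ssubset_iff_of_subset ?_).2 ⟨π, ?_, ?_⟩)
    · intro π hπ
      simp only [mem_filter, mem_univ, true_and] at hπ ⊢
      simp [hπ.1, target]
    · exact mem_filter.2 ⟨mem_univ _, by rw [h1, target, if_pos (Or.inl rfl)], h1⟩
    · simp [h2, hBc]
  · refine lt_of_lt_of_le (b := #{π : Order n | π t = B ∧ π r = A}) ?_ ?_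
    · obtain ⟨π, h1, h2, h3⟩ := exists_order₃ hlt.ne (hlt.trans htr).ne htr.ne
        hBc.symm hAc.symm hAB.symm
      refine Finset.card_lt_card ((Finset.ssubset_iff_of_subset hsub).2 ⟨π, ?_, ?_⟩)
      · simp [h2, h3]
      · intro h
        have h4 := (mem_filter.1 h).2.1
        rw [h1, h2, target, if_pos (Or.inr rfl)] at h4
        exact hAB h4.symm
    · rw [card_order_two htr.ne hAB.symm hlt.ne hAc.symm]
      refine Finset.card_le_card fun π hπ => ?_
      simp only [mem_filter, mem_univ, true_and] at hπ ⊢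
      simp [hπ, target]

/-- If `A` is present at NOT, the target is `B`, still to come, and the first candidate is not `c`.
Without this last restriction such orders correspond bijectively to those with `c` first and `A`
still to come, for which obedience obtains `A`. -/
theorem card_not_lt (hAB : A ≠ B) (hAc : A ≠ c) (hBc : B ≠ c)
    {t r : Fin n} (htr : t < r) (hz : (z : ℕ) = 0) :
    #{π ∈ univ.filter (fun π : Order n => t < hireRound A B c z π) | π t = A} <
      #{π ∈ univ.filter (fun π : Order n => t < hireRound A B c z π) |
        π (hireRound A B c z π) = A} := by
  simp only [apply_hireRound, Finset.filter_filter]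
  have hsup : (univ.filter fun π : Order n => π z = c ∧ t < π.symm A) ⊆
      univ.filter fun π : Order n => t < hireRound A B c z π ∧ target A B c (π z) = A := by
    intro π hπ
    simp only [mem_filter, mem_univ, true_and] at hπ ⊢
    simpa [hireRound, hπ.1, target] using hπ.2
  have hsub : (univ.filter fun π : Order n => t < hireRound A B c z π ∧ π t = A) ⊆
      univ.filter fun π : Order n => π t = A ∧ t < π.symm B := by
    intro π hπ
    simp only [mem_filter, mem_univ, true_and] at hπ ⊢
    obtain ⟨h1, h2⟩ := hπ
    refine ⟨h2, ?_⟩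
    unfold hireRound target at h1
    split_ifs at h1
    · rw [← h2, Equiv.symm_apply_apply] at h1
      exact absurd h1 (lt_irrefl _)
    · exact h1
  refine lt_of_lt_of_le ?_ (Finset.card_le_card hsup)
  rcases eq_or_lt_of_le (show z ≤ t from Fin.le_def.2 (by omega)) with rfl | hlt
  · obtain ⟨π, h1, h2⟩ := exists_order₂ htr.ne hAc.symm
    rw [Finset.card_eq_zero.2, Finset.card_pos]
    · exact ⟨π, by simpa [h1, ← h2] using htr⟩
    · refine Finset.filter_eq_empty_iff.2 fun π _ => ?_
      rintro ⟨h1, h2⟩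
      have : hireRound A B c z π = z := by simp [hireRound_eq_iff, h2, target]
      exact absurd h1 (by simp [this])
  · have hcard : #{π : Order n | π t = A ∧ t < π.symm B} =
        #{π : Order n | π z = c ∧ t < π.symm A} := by
      obtain ⟨h, h1, h2⟩ := exists_order₂ hAB hAc.symm
      -- Rename `A` to `c` and `B` to `A`, and exchange rounds `z` and `t`; positions after `t` are
      -- unaffected.
      refine Finset.card_equiv ((Equiv.mulLeft h).trans (Equiv.mulRight (Equiv.swap z t)))
        fun π => ?_
      have hsymm : (h * π * Equiv.swap z t).symm A = Equiv.swap z t (π.symm B) := by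
        rw [Equiv.symm_apply_eq]
        simp [h2]
      have hlt' : t < Equiv.swap z t (π.symm B) ↔ t < π.symm B := by
        rw [Equiv.swap_apply_def]
        split_ifs with h3 h4
        · simp [h3, hlt.le]
        · simp [h4, hlt.le]
        · rfl
      simp only [mem_filter, mem_univ, true_and, Equiv.trans_apply, Equiv.coe_mulLeft,
        Equiv.coe_mulRight, hsymm, hlt', Equiv.Perm.mul_apply, Equiv.swap_apply_left, ← h1,
        h.injective.eq_iff]
    rw [← hcard]
    obtain ⟨π, h1, h2, h3⟩ := exists_order₃ hlt.ne (hlt.trans htr).ne htr.ne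
      hAc.symm hBc.symm hAB
    refine Finset.card_lt_card ((Finset.ssubset_iff_of_subset hsub).2 ⟨π, ?_, ?_⟩)
    · simpa [h2, ← h3] using htr
    · intro h
      have h4 := (mem_filter.1 h).2.1
      rw [hireRound, h1, target, if_pos (Or.inr rfl), ← h2, Equiv.symm_apply_apply] at h4
      exact lt_irrefl _ h4

theorem targetMechanism_isPersuasive_gapInstance (hAB : A ≠ B) (hAc : A ≠ c) (hBc : B ≠ c)
    (hz : (z : ℕ) = 0) :
    (targetMechanism A B c).IsPersuasive .noDisclosure (gapInstance A B) := by
  have hle : ∀ i, i ≠ A → (gapInstance A B).recv i ≤ 2 := by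
    intro i hi
    have hn : (1 : ℝ) / n ≤ 1 := by
      rw [div_le_one (by exact_mod_cast i.pos)]
      exact_mod_cast i.pos
    linarith [gapInstance_recv_le (B := B) hi]
  have hdom := sum_le_sum_of_card_lt (gapInstance A B).recv_nonneg (gapInstance_recv_A hAB) hle
  refine targetMechanism_isPersuasive hz _ (fun t r htr => ?_) fun t => ?_
  · exact hdom _ (fun π => π r) (fun π => π t)
      (card_hire_lt hAB hAc hBc htr (Fin.le_def.2 (by omega)))
  · by_cases hlast : ∃ r, t < r
    · obtain ⟨r, htr⟩ := hlast
      exact hdom _ (fun π => π t) (fun π => π (hireRound A B c z π))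
        (card_not_lt hAB hAc hBc htr hz)
    · push Not at hlast
      have : (univ.filter fun π : Order n => t < hireRound A B c z π) = ∅ :=
        Finset.filter_eq_empty_iff.2 fun π _ => not_lt.2 (hlast _)
      simp [this]

theorem le_targetMechanism_senderValue (hz : (z : ℕ) = 0) (obj : Objective) :
    1 - 2 / (n : ℝ) ≤
      (targetMechanism A B c).senderValue .noDisclosure (gapInstance A B) obj := by
  have hn : (0 : ℝ) < n := by exact_mod_cast A.pos
  have hfac : (0 : ℝ) < Nat.factorial n := by exact_mod_cast Nat.factorial_pos n
  have h : ∀ π : Order n, 1 - (if π z = A then (1 : ℝ) else 0) - (if π z = c then (1 : ℝ) else 0) ≤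
      payoffFrom 0 (obedient .noDisclosure n) ((gapInstance A B).senderPayoff obj) π
        (hireAt (hireRound A B c z π)) := by
    intro π
    rw [payoffFrom_obedient_hireAt _ _ (by simp), apply_hireRound]
    have hnn := gapInstance_senderPayoff_nonneg (A := A) (B := B) obj (target A B c (π z))
    by_cases h1 : π z = A
    · rw [if_pos h1]
      split_ifs <;> linarith
    · by_cases h2 : π z = c
      · rw [if_pos h2, if_neg h1]
        linarith
      · rw [if_neg h1, if_neg h2, target, if_neg (by tauto), gapInstance_senderPayoff_B]
        norm_num
  rw [Mechanism.senderValue, targetMechanism_expect hz]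
  refine le_trans (le_of_eq ?_) (mul_le_mul_of_nonneg_left
    (Finset.sum_le_sum fun π _ => h π) (by positivity))
  have hsum : ∀ x : Fin n, ∑ π : Order n, (if π z = x then (1 : ℝ) else 0) =
      Nat.factorial n / n := fun x => by
    rw [eq_div_iff hn.ne', mul_comm, sum_apply_eq]
  rw [Finset.sum_sub_distrib, Finset.sum_sub_distrib, hsum, hsum, Finset.sum_const, nsmul_one,
    Finset.card_univ, card_order]
  field_simp
  ring

end Dominance

end Persuasion

theorem mainTheorem6 (ε : ℝ) (hε : 0 < ε) :
    ∃ (n : ℕ) (_ : 0 < n) (I : Persuasion.Instance n),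
      ∀ obj : Persuasion.Objective, ∃ OPT : ℝ, I.IsBenchmarkOptimum obj OPT ∧
        ∀ φ : Persuasion.Mechanism n, φ.IsPersuasive .disclosure I →
          φ.senderValue .disclosure I obj ≤ (1 / 2 + ε) * OPT := by
  -- It must hold that `1 / (n - 1) + 3 / n + 2 * ε / n ≤ ε`. The first two terms are at most `4 *
  -- (ε / 8)` by the choice of `m`, and the last is at most `ε / 2` since `n ≥ 4`.
  obtain ⟨m, hm⟩ := exists_nat_gt (8 / ε)
  have hn4 : 4 ≤ m + 4 := by omega
  set n := m + 4 with hn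
  have hnr : (n : ℝ) = m + 4 := by rw [hn]; push_cast; ring
  have hm0 : (0 : ℝ) ≤ m := Nat.cast_nonneg m
  have hAB : (⟨1, by omega⟩ : Fin n) ≠ ⟨0, by omega⟩ := by simp
  have hAc : (⟨1, by omega⟩ : Fin n) ≠ ⟨2, by omega⟩ := by simp
  have hBc : (⟨0, by omega⟩ : Fin n) ≠ ⟨2, by omega⟩ := by simp
  have hz : ((⟨0, by omega⟩ : Fin n) : ℕ) = 0 := rfl
  refine ⟨n, by omega, Persuasion.gapInstance ⟨1, by omega⟩ ⟨0, by omega⟩, fun obj => ?_⟩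
  obtain ⟨v, hv, hle⟩ := Persuasion.Instance.exists_isBenchmarkOptimum _ obj
    (Persuasion.targetMechanism_isPersuasive_gapInstance hAB hAc hBc hz)
  refine ⟨v, hv, fun φ hφ => (hφ.senderValue_gapInstance_le hAB obj).trans ?_⟩
  have hlow := (Persuasion.le_targetMechanism_senderValue hz obj).trans hle
  have h1 : (1 : ℝ) / (n - 1) ≤ ε / 8 := by
    rw [div_le_iff₀ (by linarith)]
    rw [div_lt_iff₀ hε] at hm
    nlinarith
  have h2 : (1 : ℝ) / n ≤ 1 / (n - 1) :=
    one_div_le_one_div_of_le (by linarith) (by linarith)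
  have h3 : (1 : ℝ) / n ≤ 1 / 4 := one_div_le_one_div_of_le (by norm_num) (by linarith)
  have h4 : (2 : ℝ) / n = 2 * (1 / n) := by ring
  rw [h4] at hlow ⊢
  have h5 := mul_le_mul_of_nonneg_left hlow (by linarith : (0 : ℝ) ≤ 1 / 2 + ε)
  refine le_trans ?_ h5
  nlinarith
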